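/- Theorem (combinatorial model for biclosed sets of type $\widetilde{C}_n$). Let $n \ge 1$ and $N = 2n+1$. Let $V$ be the real vector space spanned by vectors $\widetilde{e}_i$ ($i \in \mathbb{Z}$) modulo the relations $\widetilde{e}_{i+N} = \widetilde{e}_i + \widetilde{e}_N$ and $\widetilde{e}_{-i} = -\widetilde{e}_i$ for all $i\in\mathbb{Z}$. The positive roots of type $\widetilde{C}_n$ are the vectors $$\Phi^+ = \{\widetilde{e}_j - \widetilde{e}_i : i, j \in \mathbb{Z} \setminus N\mathbb{Z},\ i < j,\ i \not\equiv j \bmod N\} \subset V.$$ A subset $J \subseteq \Phi^+$ is closed if, for all $\alpha, \beta \in J$ and $\gamma \in \Phi^+$ with $\gamma \in \mathbb{R}_{>0}\alpha + \mathbb{R}_{>0}\beta$, we have $\gamma \in J$; a subset $B \subseteq \Phi^+$ is biclosed if both $B$ and $\Phi^+ \setminus B$ are closed. Call a (strict) total order $\prec$ on $\mathbb{Z}$ invariant if $i \prec j$ implies both $i + N \prec j + N$ and $-j \prec -i$, for all $i, j \in \mathbb{Z}$. For an invariant total order $\prec$ put $$I(\prec) = \{\widetilde{e}_j - \widetilde{e}_i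 : i, j \in \mathbb{Z} \setminus N\mathbb{Z},\ i < j,\ i \succ j,\ i \not\equiv j \bmod N\}.$$ Then: 1. for every invariant total order $\prec$ on $\mathbb{Z}$, the set $I(\prec)$ is a biclosed subset of $\Phi^+$; 2. every biclosed subset of $\Phi^+$ equals $I(\prec)$ for some invariant total order $\prec$ on $\mathbb{Z}$; 3. for two invariant total orders $\prec_1, \prec_2$ on $\mathbb{Z}$, we have $I(\prec_1) = I(\prec_2)$ if and only if there is a (possibly empty) collection of residue classes $r + N\mathbb{Z}$, each of them an interval (order-convex subset) for $\prec_1$, such that $\prec_2$ is obtained from $\prec_1$ by reversing the order inside each class of the collection and leaving all other comparisons unchanged. -/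

import Mathlib

namespace AffineC

noncomputable section

/-- The period `N = 2n + 1`. -/
abbrev period (n : ℕ) : ℤ := 2 * (n : ℤ) + 1

/-- The span, in the free real vector space on symbols `e_i` (`i ∈ ℤ`), of the relations
`e_{i+N} = e_i + e_N` and `e_{-i} = -e_i`. -/
def relations (n : ℕ) : Submodule ℝ (ℤ →₀ ℝ) :=
  Submodule.span ℝ
    ({v | ∃ i : ℤ, v = Finsupp.single (i + period n) 1
        - (Finsupp.single i 1 + Finsupp.single (period n) 1)} ∪
     {v | ∃ i : ℤ, v = Finsupp.single (-i) 1 + Finsupp.single i 1})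

/-- The real vector space spanned by the vectors `e_i` (`i ∈ ℤ`) modulo the relations
`e_{i+N} = e_i + e_N` and `e_{-i} = -e_i`. -/
abbrev Vec (n : ℕ) : Type := (ℤ →₀ ℝ) ⧸ relations n

/-- The vector `e_i`. -/
def e (n : ℕ) (i : ℤ) : Vec n := (relations n).mkQ (Finsupp.single i 1)

/-- The pairs `(i, j)` that index positive roots: `i < j`, neither of `i`, `j` is divisible by `N`,
and `i`, `j` are incongruent modulo `N`. -/
def IsRootPair (n : ℕ) (i j : ℤ) : Prop :=
  i < j ∧ ¬ period n ∣ i ∧ ¬ period n ∣ j ∧ ¬ i ≡ j [ZMOD period n]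

/-- The positive roots `e_j - e_i` of the affine root system of type `C`. -/
def posRoots (n : ℕ) : Set (Vec n) :=
  {v | ∃ i j : ℤ, IsRootPair n i j ∧ v = e n j - e n i}

/-- `J` is closed in the set `P` of positive roots: a root in `P` that is a combination of two
elements of `J` with positive real coefficients lies in `J`. -/
def IsClosedIn {V : Type*} [AddCommGroup V] [Module ℝ V] (P J : Set V) : Prop :=
  ∀ α ∈ J, ∀ β ∈ J, ∀ γ ∈ P, (∃ a b : ℝ, 0 < a ∧ 0 < b ∧ γ = a • α + b • β) → γ ∈ J

/-- `B` is a biclosed subset of the set `P` of positive roots. -/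
def IsBiclosed {V : Type*} [AddCommGroup V] [Module ℝ V] (P B : Set V) : Prop :=
  B ⊆ P ∧ IsClosedIn P B ∧ IsClosedIn P (P \ B)

/-- `r` (read `r i j` as `i ≺ j`) is a strict total order on `ℤ` that is invariant under
translation by `N` and under negation. -/
structure IsInvariantOrder (n : ℕ) (r : ℤ → ℤ → Prop) : Prop where
  irrefl : ∀ i, ¬ r i i
  trans : ∀ i j k, r i j → r j k → r i k
  total : ∀ i j, i ≠ j → r i j ∨ r j i
  translation : ∀ i j, r i j → r (i + period n) (j + period n)
  negation : ∀ i j, r i j → r (-j) (-i)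

/-- The set of all `e_j - e_i` with `(i, j)` indexing a positive root and `j ≺ i`. -/
def inversionSet (n : ℕ) (r : ℤ → ℤ → Prop) : Set (Vec n) :=
  {v | ∃ i j : ℤ, IsRootPair n i j ∧ r j i ∧ v = e n j - e n i}

/-- The residue class `c + Nℤ`. -/
def residueClass (n : ℕ) (c : ℤ) : Set ℤ := {x | x ≡ c [ZMOD period n]}

/-- `S` is an interval for the order `r`. -/
def IsInterval (r : ℤ → ℤ → Prop) (S : Set ℤ) : Prop :=
  ∀ x ∈ S, ∀ z ∈ S, ∀ y, r x y → r y z → y ∈ S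

/-- The relation obtained from `r` by reversing it inside each of the residue classes `c + Nℤ`
with `c ∈ R`, and leaving all other comparisons unchanged. -/
def reverseOn (n : ℕ) (R : Set ℤ) (r : ℤ → ℤ → Prop) (x y : ℤ) : Prop :=
  ((∃ c ∈ R, x ∈ residueClass n c ∧ y ∈ residueClass n c) ∧ r y x) ∨
  ((¬ ∃ c ∈ R, x ∈ residueClass n c ∧ y ∈ residueClass n c) ∧ r x y)

/-- `s` is obtained from `r` by reversing `r` on some (possibly none, possibly several) residue
classes modulo `N` that are intervals for `r`. -/
def SameUpToReversal (n : ℕ) (r s : ℤ → ℤ → Prop) : Prop :=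
  ∃ R : Set ℤ, (∀ c ∈ R, IsInterval r (residueClass n c)) ∧
    ∀ x y, s x y ↔ reverseOn n R r x y

end

end AffineC

namespace AffineC

/-! Write `i ≺ j` as a sign attached to the vector `e_j - e_i`; translation and negation invariance
are exactly compatibility with the relations of `V`. The signed indicators of nonzero residues kill
`e_N` and serve as coordinates on the finite part of a root; the height `e_i ↦ i` recovers the
multiple of `e_N`.

Inversion sets are biclosed: the complement is the inversion set of the reversed order, so
closedness is enough. If a root is `a • α + b • β`, the coordinates force it to share an endpoint
with `α` or `β`, up to translation and negation. What remains is a short list of rank two relations,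
each settled by transitivity and reflection (`IsInvariantOrder.closed_of_endpoint`).

Every biclosed `B` occurs: call a vector ascending if a positive multiple lies in the complement of
`B` or in `-B`. Height and biclosedness forbid three ascending vectors with sum zero, which gives
consistent comparisons of incongruent integers. `extend` then orders each residue class, upwards
unless other classes force it down; `not_forcedDown` shows that no class is forced both ways.

Fibres: the inversion set determines all comparisons of incongruent integers, while each class
carries one of only two opposite orders. A class on which two orders disagree must be an interval,
since an outside element between two of its members would fix its direction. -/

/-- The signed indicator of `c` and `-c`. -/
def signedIndicator {R : Type*} [Neg R] [DecidableEq R] (c x : R) : ℝ :=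
  (if x = c then 1 else 0) - (if x = -c then 1 else 0)

/-! ### Coordinates of roots modulo `N` -/

section Combinatorics

variable {R : Type*} [CommRing R] [DecidableEq R]

theorem eq_of_signedIndicator_proportional (h2 : ∀ x : R, x = -x → x = 0) {k l p q : R}
    (hk : k ≠ 0) (hl : l ≠ 0) (hp : p ≠ 0) (hq : q ≠ 0) (hkl : k ≠ l) (hpq : p ≠ q) {t : ℝ}
    (ht : 0 < t)
    (H : ∀ c : R, c ≠ 0 → signedIndicator c l - signedIndicator c k =
      t * (signedIndicator c q - signedIndicator c p)) :
    t = 1 ∧ ((l = q ∧ k = p) ∨ (l = -p ∧ k = -q)) := by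
  have hk' := mt (h2 k) hk
  have hl' := mt (h2 l) hl
  have hp' := mt (h2 p) hp
  have hq' := mt (h2 q) hq
  have H1 := H k hk
  have H2 := H l hl
  have H3 := H p hp
  have H4 := H q hq
  simp only [signedIndicator, mul_sub, mul_ite, mul_one, mul_zero] at H1 H2 H3 H4
  clear H
  grind

/-- At `c = q` the left side is at least 1, and only the four listed coincidences can contribute
positively on the right. -/
theorem exists_endpoint_of_signedIndicator (h2 : ∀ x : R, x = -x → x = 0) {i j k l p q : R}
    (hq : q ≠ 0) (hpq : p ≠ q) {a b : ℝ} (ha : 0 < a) (hb : 0 < b)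
    (H : ∀ c : R, c ≠ 0 → signedIndicator c q - signedIndicator c p =
      a * (signedIndicator c j - signedIndicator c i) +
      b * (signedIndicator c l - signedIndicator c k)) :
    j = q ∨ i = -q ∨ l = q ∨ k = -q := by
  have hq' := mt (h2 q) hq
  have H4 := H q hq
  simp only [signedIndicator] at H4
  clear H
  by_contra! hc
  obtain ⟨h1, h3, h4, h5⟩ := hc
  simp only [h1, h3, h4, h5, hpq, hq', if_true, if_false] at H4
  have e1 : (0:ℝ) ≤ if j = -q then 1 else 0 := by split_ifs <;> norm_num
  have e2 : (0:ℝ) ≤ if i = q then 1 else 0 := by split_ifs <;> norm_num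
  have e3 : (0:ℝ) ≤ if l = -q then 1 else 0 := by split_ifs <;> norm_num
  have e4 : (0:ℝ) ≤ if k = q then 1 else 0 := by split_ifs <;> norm_num
  have e5 : (0:ℝ) ≤ if p = -q then 1 else 0 := by split_ifs <;> norm_num
  nlinarith

/-- Moving the `a`-term to the left gives weights `1 - a`, `-1`, `a` on `q`, `p`, `i`. The remaining
`b`-term involves at most two residues up to sign, with weights of equal size, so some weight must
vanish or two of the residues must be opposite. -/
theorem coefficient_of_signedIndicator (h2 : ∀ x : R, x = -x → x = 0) {i k l p q : R}
    (hi : i ≠ 0) (hp : p ≠ 0) (hq : q ≠ 0) (hiq : i ≠ q) (hkl : k ≠ l) (hpq : p ≠ q)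
    (hip : i ≠ p) {a b : ℝ} (ha : 0 < a) (hb : 0 < b)
    (H : ∀ c : R, c ≠ 0 → signedIndicator c q - signedIndicator c p =
      a * (signedIndicator c q - signedIndicator c i) +
      b * (signedIndicator c l - signedIndicator c k)) :
    a = 1 ∨ (i = -q ∧ a = 1 / 2) ∨ (p = -q ∧ a = 2) := by
  have hi' := mt (h2 i) hi
  have hp' := mt (h2 p) hp
  have hq' := mt (h2 q) hq
  have H1 := H i hi
  have H3 := H p hp
  have H4 := H q hq
  simp only [signedIndicator, mul_sub, mul_ite, mul_one, mul_zero] at H1 H3 H4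
  clear H
  by_cases c1 : i = -q <;> by_cases c2 : p = -q <;> by_cases c3 : i = -p <;> grind

end Combinatorics

/-! ### Residues modulo the odd number `N` -/

section Residues

variable {n : ℕ}

theorem period_pos (n : ℕ) : 0 < period n := by unfold period; omega

theorem coe_period (n : ℕ) : ((2 * n + 1 : ℕ) : ℤ) = period n := by simp [period]

theorem residue_eq_iff {i j : ℤ} :
    (i : ZMod (2 * n + 1)) = j ↔ i ≡ j [ZMOD period n] := by
  rw [ZMod.intCast_eq_intCast_iff, coe_period]

theorem residue_eq_zero_iff {i : ℤ} : (i : ZMod (2 * n + 1)) = 0 ↔ period n ∣ i := by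
  rw [ZMod.intCast_zmod_eq_zero_iff_dvd, coe_period]

theorem residue_period : ((period n : ℤ) : ZMod (2 * n + 1)) = 0 :=
  residue_eq_zero_iff.2 dvd_rfl

theorem residue_add_mul (i m : ℤ) :
    ((i + m * period n : ℤ) : ZMod (2 * n + 1)) = i := by
  rw [Int.cast_add, Int.cast_mul, residue_period, mul_zero, add_zero]

theorem exists_eq_add_mul_of_residue_eq {i j : ℤ} (h : (i : ZMod (2 * n + 1)) = j) :
    ∃ m : ℤ, i = j + m * period n := by
  obtain ⟨m, hm⟩ := (residue_eq_iff.1 h).symm.dvd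
  exact ⟨m, by linarith⟩

theorem eq_zero_of_eq_neg_residue (x : ZMod (2 * n + 1)) (h : x = -x) : x = 0 := by
  have h1 : ((2 * n + 1 : ℕ) : ZMod (2 * n + 1)) = 0 := ZMod.natCast_self _
  push_cast at h1
  linear_combination x * h1 - (n : ZMod (2 * n + 1)) * h

end Residues

/-! ### Relations and linear functionals on `V` -/

section Vectors

variable {n : ℕ}

theorem e_add_period (i : ℤ) : e n (i + period n) = e n i + e n (period n) := by
  rw [← sub_eq_zero]
  have h : Finsupp.single (i + period n) (1 : ℝ)
      - (Finsupp.single i 1 + Finsupp.single (period n) 1) ∈ relations n :=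
    Submodule.subset_span (Or.inl ⟨i, rfl⟩)
  have h' := (Submodule.Quotient.mk_eq_zero _).2 h
  rw [← Submodule.mkQ_apply, map_sub, map_add] at h'
  exact h'

theorem e_neg (i : ℤ) : e n (-i) = -e n i := by
  rw [eq_neg_iff_add_eq_zero]
  have h : Finsupp.single (-i) (1 : ℝ) + Finsupp.single i 1 ∈ relations n :=
    Submodule.subset_span (Or.inr ⟨i, rfl⟩)
  have h' := (Submodule.Quotient.mk_eq_zero _).2 h
  rw [← Submodule.mkQ_apply, map_add] at h'
  exact h'

theorem e_add_mul (i m : ℤ) :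
    e n (i + m * period n) = e n i + (m : ℝ) • e n (period n) := by
  induction m with
  | zero => simp
  | succ m ih =>
    rw [add_mul, one_mul, ← add_assoc, e_add_period, ih]
    push_cast
    module
  | pred m ih =>
    have h := e_add_period (n := n) (i + (-m - 1 : ℤ) * period n)
    rw [show i + (-m - 1 : ℤ) * period n + period n = i + -m * period n by ring, ih] at h
    rw [← sub_eq_iff_eq_add] at h
    rw [← h]
    push_cast
    module

theorem exists_functional (g : ℤ → ℝ) (h1 : ∀ i, g (i + period n) = g i + g (period n))
    (h2 : ∀ i, g (-i) = -g i) : ∃ φ : Vec n →ₗ[ℝ] ℝ, ∀ i, φ (e n i) = g i := by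
  refine ⟨(relations n).liftQ (Finsupp.linearCombination ℝ g) ?_, fun i => ?_⟩
  · rw [relations, Submodule.span_le]
    rintro v (⟨i, rfl⟩ | ⟨i, rfl⟩)
    · simp [h1]
    · simp [h2]
  · simp [e]

theorem exists_height (n : ℕ) : ∃ φ : Vec n →ₗ[ℝ] ℝ, ∀ i, φ (e n i) = i :=
  exists_functional _ (fun i => by push_cast; ring) (fun i => by push_cast; ring)

theorem exists_indicator {c : ZMod (2 * n + 1)} (hc : c ≠ 0) :
    ∃ φ : Vec n →ₗ[ℝ] ℝ, φ (e n (period n)) = 0 ∧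
      ∀ i : ℤ, φ (e n i) = signedIndicator c (i : ZMod (2 * n + 1)) := by
  have h0 : signedIndicator c ((period n : ℤ) : ZMod (2 * n + 1)) = 0 := by
    rw [residue_period]
    simp [signedIndicator, hc.symm, (neg_ne_zero.2 hc).symm]
  obtain ⟨φ, h⟩ := exists_functional (n := n)
    (fun i : ℤ => signedIndicator c (i : ZMod (2 * n + 1)))
    (fun i => by
      simp only [h0, add_zero]
      rw [Int.cast_add, residue_period, add_zero])
    (fun i => by
      simp only [signedIndicator, Int.cast_neg, neg_eq_iff_eq_neg]
      ring_nf)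
  exact ⟨φ, by rw [h, h0], h⟩

end Vectors

/-! ### Symmetries of invariant orders -/

namespace IsInvariantOrder

variable {n : ℕ} {r : ℤ → ℤ → Prop} (hr : IsInvariantOrder n r)

include hr

theorem asymm {i j : ℤ} (h : r i j) : ¬ r j i := fun h' => hr.irrefl i (hr.trans _ _ _ h h')

theorem not_iff {i j : ℤ} (h : i ≠ j) : ¬ r i j ↔ r j i :=
  ⟨fun h' => (hr.total i j h).resolve_left h', fun h' => hr.asymm h'⟩

theorem add_period_iff (i j : ℤ) : r (i + period n) (j + period n) ↔ r i j := by
  refine ⟨fun h => ?_, hr.translation i j⟩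
  by_contra h'
  have hij : i ≠ j := by
    rintro rfl
    exact hr.irrefl _ h
  exact hr.asymm h (hr.translation _ _ ((hr.not_iff hij).1 h'))

theorem add_mul_iff (i j m : ℤ) : r (i + m * period n) (j + m * period n) ↔ r i j := by
  induction m with
  | zero => simp
  | succ m ih =>
    rw [← ih, show i + (m + 1 : ℤ) * period n = i + m * period n + period n by ring,
      show j + (m + 1 : ℤ) * period n = j + m * period n + period n by ring, hr.add_period_iff]
  | pred m ih =>
    rw [← ih, ← hr.add_period_iff]
    ring_nf

theorem neg_iff (i j : ℤ) : r (-j) (-i) ↔ r i j :=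
  ⟨fun h => by simpa using hr.negation _ _ h, hr.negation i j⟩

theorem lt_add_mul {x m : ℤ} (h : r x (x + period n)) (hm : 0 < m) :
    r x (x + m * period n) := by
  induction m, hm using Int.leInduction with
  | base => simpa using h
  | succ m hm ih =>
    refine hr.trans _ _ _ h ?_
    rw [show x + (m + 1) * period n = x + m * period n + period n by ring, hr.add_period_iff]
    exact ih

theorem add_mul_lt {x m : ℤ} (h : r (x + period n) x) (hm : 0 < m) :
    r (x + m * period n) x := by
  induction m, hm using Int.leInduction with
  | base => simpa using h
  | succ m hm ih =>
    refine hr.trans _ (x + period n) _ ?_ h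
    rw [show x + (m + 1) * period n = x + m * period n + period n by ring, hr.add_period_iff]
    exact ih

theorem lt_add_mul_neg {x m : ℤ} (h : r (x + period n) x) (hm : m < 0) :
    r x (x + m * period n) := by
  rw [← hr.add_mul_iff _ _ (-m)]
  have := hr.add_mul_lt h (neg_pos.2 hm)
  simpa using this

theorem step (x : ℤ) : r x (x + period n) ∨ r (x + period n) x :=
  hr.total _ _ (by have := period_pos n; omega)

theorem reverse : IsInvariantOrder n fun i j => r j i where
  irrefl := hr.irrefl
  trans _ _ _ h h' := hr.trans _ _ _ h' h
  total i j h := hr.total j i h.symm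
  translation i j := hr.translation j i
  negation i j := hr.negation j i

end IsInvariantOrder

/-! ### Positive relations between roots -/

section Closedness

variable {n : ℕ}

/-- The indicators match the endpoints modulo `N`, directly or after negation, and the height makes
`s` an integer. The term in `e_N` allows for roots in the plane spanned by a given root and `e_N`.
-/
theorem root_proportional {k l p q : ℤ}
    (hk : (k : ZMod (2 * n + 1)) ≠ 0) (hl : (l : ZMod (2 * n + 1)) ≠ 0)
    (hp : (p : ZMod (2 * n + 1)) ≠ 0) (hq : (q : ZMod (2 * n + 1)) ≠ 0)
    (hkl : (k : ZMod (2 * n + 1)) ≠ l) (hpq : (p : ZMod (2 * n + 1)) ≠ q) {t s : ℝ}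
    (ht : 0 < t)
    (h : e n l - e n k = t • (e n q - e n p) + s • e n (period n)) :
    t = 1 ∧ ∃ m : ℤ, s = m ∧
      ∀ r, IsInvariantOrder n r → (r k l ↔ r p (q + m * period n)) := by
  obtain ⟨rfl, hc⟩ := eq_of_signedIndicator_proportional eq_zero_of_eq_neg_residue
    hk hl hp hq hkl hpq ht (fun c hc => by
      obtain ⟨φ, h0, hφ⟩ := exists_indicator hc
      simpa [h0, hφ] using congrArg φ h)
  refine ⟨rfl, ?_⟩
  obtain ⟨φ, hφ⟩ := exists_height n
  have hh := congrArg φ h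
  simp only [map_sub, map_add, map_smul, hφ, smul_eq_mul, one_mul] at hh
  have hN : ((period n : ℤ) : ℝ) ≠ 0 := by exact_mod_cast (period_pos n).ne'
  rcases hc with ⟨h1, h2⟩ | ⟨h1, h2⟩
  · obtain ⟨u, rfl⟩ := exists_eq_add_mul_of_residue_eq h1
    obtain ⟨v, rfl⟩ := exists_eq_add_mul_of_residue_eq h2
    refine ⟨u - v, mul_right_cancel₀ hN ?_, fun r hr => ?_⟩
    · push_cast at hh ⊢
      linarith
    · rw [← hr.add_mul_iff p _ v]
      ring_nf
  · rw [← Int.cast_neg] at h1 h2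
    obtain ⟨u, rfl⟩ := exists_eq_add_mul_of_residue_eq h1
    obtain ⟨v, rfl⟩ := exists_eq_add_mul_of_residue_eq h2
    refine ⟨u - v, mul_right_cancel₀ hN ?_, fun r hr => ?_⟩
    · push_cast at hh ⊢
      linarith
    · rw [← hr.neg_iff, ← hr.add_mul_iff _ _ u]
      ring_nf

/-- A root that is a positive multiple of another root is ordered in the same way. -/
theorem IsInvariantOrder.iff_of_proportional {r : ℤ → ℤ → Prop} (hr : IsInvariantOrder n r)
    {k l p q : ℤ}
    (hk : (k : ZMod (2 * n + 1)) ≠ 0) (hl : (l : ZMod (2 * n + 1)) ≠ 0)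
    (hp : (p : ZMod (2 * n + 1)) ≠ 0) (hq : (q : ZMod (2 * n + 1)) ≠ 0)
    (hkl : (k : ZMod (2 * n + 1)) ≠ l) (hpq : (p : ZMod (2 * n + 1)) ≠ q) {b t : ℝ}
    (hb : 0 < b) (ht : 0 < t) (h : b • (e n l - e n k) = t • (e n q - e n p)) :
    r k l ↔ r p q := by
  have h' : e n l - e n k = (b⁻¹ * t) • (e n q - e n p) + (0 : ℝ) • e n (period n) := by
    rw [zero_smul, add_zero, mul_smul, ← h, inv_smul_smul₀ hb.ne']
  obtain ⟨-, m, hm, H⟩ := root_proportional hk hl hp hq hkl hpq (by positivity) h'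
  have hm : m = 0 := by exact_mod_cast hm.symm
  simpa [hm] using H r hr

theorem IsInvariantOrder.closed_of_endpoint {r : ℤ → ℤ → Prop} (hr : IsInvariantOrder n r)
    {i k l p q : ℤ} (hi : (i : ZMod (2 * n + 1)) ≠ 0)
    (hk : (k : ZMod (2 * n + 1)) ≠ 0) (hl : (l : ZMod (2 * n + 1)) ≠ 0)
    (hp : (p : ZMod (2 * n + 1)) ≠ 0) (hq : (q : ZMod (2 * n + 1)) ≠ 0)
    (hiq : (i : ZMod (2 * n + 1)) ≠ q)
    (hkl : (k : ZMod (2 * n + 1)) ≠ l) (hpq : (p : ZMod (2 * n + 1)) ≠ q) {a b : ℝ}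
    (ha : 0 < a) (hb : 0 < b)
    (h : e n q - e n p = a • (e n q - e n i) + b • (e n l - e n k))
    (h1 : r i q) (h2 : r k l) : r p q := by
  by_cases hip : (i : ZMod (2 * n + 1)) = p
  · obtain ⟨m, rfl⟩ := exists_eq_add_mul_of_residue_eq hip
    rw [e_add_mul] at h
    rcases lt_trichotomy a 1 with ha1 | rfl | ha1
    · have hc : 0 < 1 - a := by linarith
      have h' : e n l - e n k =
          (b⁻¹ * (1 - a)) • (e n q - e n p) + (b⁻¹ * (a * m)) • e n (period n) := by
        rw [← inv_smul_smul₀ hb.ne' (e n l - e n k), eq_sub_of_add_eq' h.symm]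
        module
      obtain ⟨ht, u, hu, H⟩ := root_proportional hk hl hp hq hkl hpq (by positivity) h'
      rw [H r hr] at h2
      have hb' : b = 1 - a := by field_simp at ht; linarith
      have hu' : a * m = b * u := by field_simp at hu; linarith
      rw [← hr.add_mul_iff _ _ (-u), show q + u * period n + -u * period n = q by ring] at h2
      -- `m` and `u` have the same sign, so unless both vanish `p` precedes `p + mN` or `p - uN`,
      -- whichever way its class runs; both of these precede `q`.
      rcases lt_trichotomy m 0 with hm | rfl | hm
      · have hu0 : u < 0 := by
          have : (m : ℝ) < 0 := by exact_mod_cast hm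
          have : (u : ℝ) < 0 := by nlinarith
          exact_mod_cast this
        rcases hr.step p with hs | hs
        · exact hr.trans _ _ _ (hr.lt_add_mul hs (by omega)) h2
        · exact hr.trans _ _ _ (hr.lt_add_mul_neg hs hm) h1
      · simpa using h1
      · have hu0 : 0 < u := by
          have : (0 : ℝ) < m := by exact_mod_cast hm
          have : (0 : ℝ) < u := by
            by_contra hneg
            nlinarith [mul_pos ha this]
          exact_mod_cast this
        rcases hr.step p with hs | hs
        · exact hr.trans _ _ _ (hr.lt_add_mul hs hm) h1
        · exact hr.trans _ _ _ (hr.lt_add_mul_neg hs (by omega)) h2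
    -- Here `e n l - e n k` would be a multiple of `e_N`, but its coordinate at `l` is nonzero.
    · exfalso
      obtain ⟨φ, h0, hφ⟩ := exists_indicator hl
      have hh := congrArg φ h
      simp only [map_sub, map_add, map_smul, h0, smul_eq_mul, one_mul, mul_zero] at hh
      simp only [hφ] at hh
      have hl' := mt (eq_zero_of_eq_neg_residue _) hl
      simp only [signedIndicator, hl', hkl, if_true, if_false] at hh
      split_ifs at hh <;> nlinarith
    · have hc : 0 < a - 1 := by linarith
      have h' : e n l - e n k =
          (b⁻¹ * (a - 1)) • (e n p - e n q) + (b⁻¹ * (a * m)) • e n (period n) := by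
        rw [← inv_smul_smul₀ hb.ne' (e n l - e n k), eq_sub_of_add_eq' h.symm]
        module
      obtain ⟨ht, u, hu, H⟩ := root_proportional hk hl hq hp hkl hpq.symm (by positivity) h'
      rw [H r hr] at h2
      have hb' : b = a - 1 := by field_simp at ht; linarith
      have hu' : a * m = b * u := by field_simp at hu; linarith
      have h3 := hr.trans _ _ _ h1 h2
      -- From `a * m = (a - 1) * u`, a nonzero `m` lies strictly between 0 and `u`. So `p + mN ≺ p +
      -- uN` fixes the direction of the class and yields `p ≺ p + mN`.
      rcases lt_trichotomy m 0 with hm | rfl | hm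
      · have hum : u < m := by
          have : (m : ℝ) < 0 := by exact_mod_cast hm
          have : (u : ℝ) < m := by nlinarith
          exact_mod_cast this
        rcases hr.step p with hs | hs
        · have := hr.lt_add_mul hs (m := m - u) (by omega)
          rw [← hr.add_mul_iff _ _ u,
            show p + (m - u) * period n + u * period n = p + m * period n by ring] at this
          exact absurd this (hr.asymm h3)
        · exact hr.trans _ _ _ (hr.lt_add_mul_neg hs hm) h1
      · simpa using h1
      · have hum : m < u := by
          have : (0 : ℝ) < m := by exact_mod_cast hm
          have : (m : ℝ) < u := by
            by_contra hneg
            nlinarith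
          exact_mod_cast this
        rcases hr.step p with hs | hs
        · exact hr.trans _ _ _ (hr.lt_add_mul hs hm) h1
        · have := hr.lt_add_mul_neg hs (m := m - u) (by omega)
          rw [← hr.add_mul_iff _ _ u,
            show p + (m - u) * period n + u * period n = p + m * period n by ring] at this
          exact absurd this (hr.asymm h3)
  · have hpi : (p : ZMod (2 * n + 1)) ≠ i := Ne.symm hip
    rcases coefficient_of_signedIndicator eq_zero_of_eq_neg_residue hi hp hq hiq hkl hpq hip
      ha hb (fun c hc => by
        obtain ⟨φ, h0, hφ⟩ := exists_indicator hc
        simpa [h0, hφ] using congrArg φ h) with rfl | ⟨hc, rfl⟩ | ⟨hc, rfl⟩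
    · have h' : b • (e n l - e n k) = (1 : ℝ) • (e n i - e n p) := by
        rw [eq_sub_of_add_eq' h.symm]
        module
      rw [hr.iff_of_proportional hk hl hp hi hkl hpi hb one_pos h'] at h2
      exact hr.trans _ _ _ h2 h1
    · rw [← Int.cast_neg] at hc
      obtain ⟨m, rfl⟩ := exists_eq_add_mul_of_residue_eq hc
      have hp' : ((-p + m * period n : ℤ) : ZMod (2 * n + 1)) = -p := by
        rw [residue_add_mul, Int.cast_neg]
      have h' : b • (e n l - e n k) =
          (1 / 2 : ℝ) • (e n (-p + m * period n) - e n p) := by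
        rw [eq_sub_of_add_eq' h.symm, e_add_mul, e_add_mul, e_neg, e_neg]
        module
      rw [hr.iff_of_proportional hk hl hp (by rwa [hp', neg_ne_zero]) hkl
        (by rw [hp']; exact mt (eq_zero_of_eq_neg_residue _) hp) hb (by norm_num) h'] at h2
      -- The reflection `x ↦ -x + mN` reverses the order; `q` lies above its mirror image and `p`
      -- below its own, which is incompatible with `q ≺ p`.
      by_contra hn
      have hqp : r q p := (hr.not_iff (by rintro rfl; exact hpq rfl)).1 hn
      have h3 := hr.trans _ _ _ (hr.trans _ _ _ h1 hqp) h2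
      rw [hr.add_mul_iff, hr.neg_iff] at h3
      exact hn h3
    · rw [← Int.cast_neg] at hc
      obtain ⟨m, rfl⟩ := exists_eq_add_mul_of_residue_eq hc
      have hi' : ((-i + m * period n : ℤ) : ZMod (2 * n + 1)) = -i := by
        rw [residue_add_mul, Int.cast_neg]
      have h' : b • (e n l - e n k) =
          (1 : ℝ) • (e n i - e n (-i + m * period n)) := by
        rw [eq_sub_of_add_eq' h.symm, e_add_mul, e_add_mul, e_neg, e_neg]
        module
      rw [hr.iff_of_proportional hk hl (by rwa [hi', neg_ne_zero]) hi hkl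
        (by rw [hi']; exact Ne.symm (mt (eq_zero_of_eq_neg_residue _) hi)) hb one_pos h'] at h2
      refine hr.trans _ _ _ ?_ (hr.trans _ _ _ h2 h1)
      rw [hr.add_mul_iff, hr.neg_iff]
      exact h1

theorem IsInvariantOrder.closed_of_residue {r : ℤ → ℤ → Prop} (hr : IsInvariantOrder n r)
    {i j k l p q : ℤ} (hi : (i : ZMod (2 * n + 1)) ≠ 0) (hj : (j : ZMod (2 * n + 1)) ≠ 0)
    (hk : (k : ZMod (2 * n + 1)) ≠ 0) (hl : (l : ZMod (2 * n + 1)) ≠ 0)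
    (hp : (p : ZMod (2 * n + 1)) ≠ 0) (hq : (q : ZMod (2 * n + 1)) ≠ 0)
    (hij : (i : ZMod (2 * n + 1)) ≠ j)
    (hkl : (k : ZMod (2 * n + 1)) ≠ l) (hpq : (p : ZMod (2 * n + 1)) ≠ q) {a b : ℝ}
    (ha : 0 < a) (hb : 0 < b)
    (h : e n q - e n p = a • (e n j - e n i) + b • (e n l - e n k))
    (h1 : r i j) (h2 : r k l)
    (hc : (j : ZMod (2 * n + 1)) = q ∨ (i : ZMod (2 * n + 1)) = -q) : r p q := by
  rcases hc with hc | hc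
  · obtain ⟨m, rfl⟩ := exists_eq_add_mul_of_residue_eq hc
    refine hr.closed_of_endpoint (i := i + -m * period n) ?_ hk hl hp hq ?_ hkl hpq ha hb ?_
      ?_ h2
    · rwa [residue_add_mul]
    · rwa [residue_add_mul, ← hc]
    · rw [h, e_add_mul, e_add_mul]
      push_cast
      module
    · rw [← hr.add_mul_iff _ _ m]
      simpa using h1
  · rw [← Int.cast_neg] at hc
    obtain ⟨m, rfl⟩ := exists_eq_add_mul_of_residue_eq hc
    have hj' : ((-j + m * period n : ℤ) : ZMod (2 * n + 1)) = -j := by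
      rw [residue_add_mul, Int.cast_neg]
    refine hr.closed_of_endpoint (i := -j + m * period n) ?_ hk hl hp hq ?_ hkl hpq ha hb ?_
      ?_ h2
    · rwa [hj', neg_ne_zero]
    · rw [hj']
      rw [residue_add_mul, Int.cast_neg] at hij
      exact fun h => hij (by rw [← h, neg_neg])
    · rw [h, e_add_mul, e_add_mul, e_neg, e_neg]
      module
    · rw [← hr.add_mul_iff _ _ (-m), ← hr.neg_iff]
      simpa [add_comm] using h1

theorem IsInvariantOrder.closed {r : ℤ → ℤ → Prop} (hr : IsInvariantOrder n r)
    {i j k l p q : ℤ} (hi : (i : ZMod (2 * n + 1)) ≠ 0) (hj : (j : ZMod (2 * n + 1)) ≠ 0)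
    (hk : (k : ZMod (2 * n + 1)) ≠ 0) (hl : (l : ZMod (2 * n + 1)) ≠ 0)
    (hp : (p : ZMod (2 * n + 1)) ≠ 0) (hq : (q : ZMod (2 * n + 1)) ≠ 0)
    (hij : (i : ZMod (2 * n + 1)) ≠ j)
    (hkl : (k : ZMod (2 * n + 1)) ≠ l) (hpq : (p : ZMod (2 * n + 1)) ≠ q) {a b : ℝ}
    (ha : 0 < a) (hb : 0 < b)
    (h : e n q - e n p = a • (e n j - e n i) + b • (e n l - e n k))
    (h1 : r i j) (h2 : r k l) : r p q := by
  rcases exists_endpoint_of_signedIndicator eq_zero_of_eq_neg_residue hq hpq ha hb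
    (fun c hc => by
      obtain ⟨φ, h0, hφ⟩ := exists_indicator hc
      simpa [h0, hφ] using congrArg φ h) with hc | hc | hc | hc
  · exact hr.closed_of_residue hi hj hk hl hp hq hij hkl hpq ha hb h h1 h2 (Or.inl hc)
  · exact hr.closed_of_residue hi hj hk hl hp hq hij hkl hpq ha hb h h1 h2 (Or.inr hc)
  · exact hr.closed_of_residue hk hl hi hj hp hq hkl hij hpq hb ha (by rw [h, add_comm]) h2 h1
      (Or.inl hc)
  · exact hr.closed_of_residue hk hl hi hj hp hq hkl hij hpq hb ha (by rw [h, add_comm]) h2 h1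
      (Or.inr hc)

end Closedness

/-! ### Inversion sets and their fibres -/

section InversionSets

variable {n : ℕ} {r s : ℤ → ℤ → Prop}

theorem isRootPair_iff {i j : ℤ} :
    IsRootPair n i j ↔ i < j ∧ (i : ZMod (2 * n + 1)) ≠ 0 ∧ (j : ZMod (2 * n + 1)) ≠ 0 ∧
      (i : ZMod (2 * n + 1)) ≠ j := by
  simp only [IsRootPair, ne_eq, residue_eq_zero_iff, residue_eq_iff]

theorem IsInvariantOrder.mem_inversionSet_iff (hr : IsInvariantOrder n r) {i j : ℤ}
    (hij : IsRootPair n i j) : e n j - e n i ∈ inversionSet n r ↔ r j i := by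
  refine ⟨?_, fun h => ⟨i, j, hij, h, rfl⟩⟩
  rintro ⟨k, l, hkl, h, heq⟩
  obtain ⟨-, hi, hj, hij⟩ := isRootPair_iff.1 hij
  obtain ⟨-, hk, hl, hkl⟩ := isRootPair_iff.1 hkl
  exact (hr.reverse.iff_of_proportional hi hj hk hl hij hkl one_pos one_pos
    (by rw [heq])).2 h

theorem IsInvariantOrder.isClosedIn_inversionSet (hr : IsInvariantOrder n r) :
    IsClosedIn (posRoots n) (inversionSet n r) := by
  rintro _ ⟨i, j, hij, h1, rfl⟩ _ ⟨k, l, hkl, h2, rfl⟩ _ ⟨p, q, hpq, rfl⟩ ⟨a, b, ha, hb, h⟩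
  refine ⟨p, q, hpq, ?_, rfl⟩
  obtain ⟨-, hi, hj, hij⟩ := isRootPair_iff.1 hij
  obtain ⟨-, hk, hl, hkl⟩ := isRootPair_iff.1 hkl
  obtain ⟨-, hp, hq, hpq⟩ := isRootPair_iff.1 hpq
  exact hr.reverse.closed hi hj hk hl hp hq hij hkl hpq ha hb h h1 h2

theorem IsInvariantOrder.posRoots_diff_inversionSet (hr : IsInvariantOrder n r) :
    posRoots n \ inversionSet n r = inversionSet n fun i j => r j i := by
  ext v
  constructor
  · rintro ⟨⟨i, j, hij, rfl⟩, h⟩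
    rw [hr.mem_inversionSet_iff hij, hr.not_iff hij.1.ne'] at h
    exact ⟨i, j, hij, h, rfl⟩
  · rintro ⟨i, j, hij, h, rfl⟩
    refine ⟨⟨i, j, hij, rfl⟩, ?_⟩
    rw [hr.mem_inversionSet_iff hij]
    exact hr.asymm h

theorem IsInvariantOrder.isBiclosed_inversionSet (hr : IsInvariantOrder n r) :
    IsBiclosed (posRoots n) (inversionSet n r) := by
  refine ⟨?_, hr.isClosedIn_inversionSet, ?_⟩
  · rintro v ⟨i, j, hij, -, rfl⟩
    exact ⟨i, j, hij, rfl⟩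
  · rw [hr.posRoots_diff_inversionSet]
    exact hr.reverse.isClosedIn_inversionSet

/-- `mN` is the fixed point of the order-reversing reflection `x ↦ -x + 2mN`. Roots avoid multiples
of `N`, and this recovers comparisons with them. -/
theorem IsInvariantOrder.lt_mul_period_iff (hr : IsInvariantOrder n r) {i m : ℤ}
    (hi : i ≠ m * period n) : r i (m * period n) ↔ r i (-i + 2 * m * period n) := by
  have key : ∀ i j : ℤ, r i j ↔ r (-j + 2 * m * period n) (-i + 2 * m * period n) := by
    intro i j
    rw [hr.add_mul_iff, hr.neg_iff]
  constructor
  · intro h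
    refine hr.trans _ _ _ h ?_
    rw [key] at h
    convert h using 1
    ring
  · intro h
    by_contra hn
    rw [hr.not_iff hi] at hn
    have h' := (key _ _).1 hn
    rw [show -(m * period n) + 2 * m * period n = m * period n by ring] at h'
    exact hr.asymm h (hr.trans _ _ _ h' hn)

theorem iff_of_inversionSet_eq (hr : IsInvariantOrder n r) (hs : IsInvariantOrder n s)
    (h : inversionSet n r = inversionSet n s) {i j : ℤ}
    (hij : (i : ZMod (2 * n + 1)) ≠ j) : r i j ↔ s i j := by
  have ne_of_residue : ∀ {i j : ℤ}, (i : ZMod (2 * n + 1)) ≠ j → i ≠ j := by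
    rintro i j h rfl
    exact h rfl
  have swap : ∀ {i j : ℤ}, (i : ZMod (2 * n + 1)) ≠ j → (r i j ↔ s i j) →
      (r j i ↔ s j i) := by
    intro i j h' h
    rw [← hr.not_iff (ne_of_residue h'), h, hs.not_iff (ne_of_residue h')]
  have hroot : ∀ i j : ℤ, IsRootPair n i j → (r j i ↔ s j i) := by
    intro i j hij
    rw [← hr.mem_inversionSet_iff hij, h, hs.mem_inversionSet_iff hij]
  have hnonzero : ∀ i j : ℤ, (i : ZMod (2 * n + 1)) ≠ 0 → (j : ZMod (2 * n + 1)) ≠ 0 →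
      (i : ZMod (2 * n + 1)) ≠ j → (r i j ↔ s i j) := by
    intro i j hi hj hij
    rcases lt_or_gt_of_ne (ne_of_residue hij) with hlt | hlt
    · exact swap hij.symm (hroot i j (isRootPair_iff.2 ⟨hlt, hi, hj, hij⟩))
    · exact hroot j i (isRootPair_iff.2 ⟨hlt, hj, hi, hij.symm⟩)
  have hzero : ∀ i m : ℤ, (i : ZMod (2 * n + 1)) ≠ 0 →
      (r i (m * period n) ↔ s i (m * period n)) := by
    intro i m hi
    have hne : i ≠ m * period n := by
      rintro rfl
      exact hi (residue_eq_zero_iff.2 (dvd_mul_left _ _))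
    rw [hr.lt_mul_period_iff hne, hs.lt_mul_period_iff hne]
    have hc : ((-i + 2 * m * period n : ℤ) : ZMod (2 * n + 1)) = -i := by
      rw [residue_add_mul, Int.cast_neg]
    refine hnonzero _ _ hi ?_ ?_
    · rwa [hc, neg_ne_zero]
    · rw [hc]
      exact mt (eq_zero_of_eq_neg_residue _) hi
  by_cases hj : (j : ZMod (2 * n + 1)) = 0
  · obtain ⟨m, rfl⟩ := residue_eq_zero_iff.1 hj
    rw [mul_comm (period n)]
    exact hzero i m (by rwa [hj] at hij)
  by_cases hi : (i : ZMod (2 * n + 1)) = 0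
  · obtain ⟨m, rfl⟩ := residue_eq_zero_iff.1 hi
    rw [mul_comm (period n)] at hij ⊢
    exact swap hij.symm (hzero j m hj)
  · exact hnonzero i j hi hj hij

theorem mem_residueClass_iff {c x : ℤ} :
    x ∈ residueClass n c ↔ (x : ZMod (2 * n + 1)) = c := residue_eq_iff.symm

/-- Inside a residue class, an invariant order is determined by one comparison. -/
theorem IsInvariantOrder.iff_or_iff_swap (hr : IsInvariantOrder n r)
    (hs : IsInvariantOrder n s) (c : ℤ) :
    (∀ x y : ℤ, (x : ZMod (2 * n + 1)) = c → (y : ZMod (2 * n + 1)) = c →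
      (s x y ↔ r x y)) ∨
    (∀ x y : ℤ, (x : ZMod (2 * n + 1)) = c → (y : ZMod (2 * n + 1)) = c →
      (s x y ↔ r y x)) := by
  have up : ∀ {r : ℤ → ℤ → Prop}, IsInvariantOrder n r → r c (c + period n) →
      ∀ u v : ℤ, r (c + u * period n) (c + v * period n) ↔ u < v := by
    intro r hr h u v
    rw [← hr.add_mul_iff _ _ (-u), show c + u * period n + -u * period n = c by ring,
      show c + v * period n + -u * period n = c + (v - u) * period n by ring]
    rcases lt_trichotomy u v with huv | rfl | huv
    · exact iff_of_true (hr.lt_add_mul h (by omega)) huv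
    · simpa using hr.irrefl c
    · refine iff_of_false (hr.asymm ?_) (by omega)
      rw [← hr.add_mul_iff _ _ (u - v),
        show c + (v - u) * period n + (u - v) * period n = c by ring]
      exact hr.lt_add_mul h (by omega)
  have down : ∀ {r : ℤ → ℤ → Prop}, IsInvariantOrder n r → r (c + period n) c →
      ∀ u v : ℤ, r (c + u * period n) (c + v * period n) ↔ v < u :=
    fun hr h u v => up hr.reverse h v u
  have conv : ∀ {P : ℤ → ℤ → Prop}, (∀ u v : ℤ, P (c + u * period n) (c + v * period n)) →
      ∀ x y : ℤ, (x : ZMod (2 * n + 1)) = c → (y : ZMod (2 * n + 1)) = c → P x y := by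
    intro P h x y hx hy
    obtain ⟨u, rfl⟩ := exists_eq_add_mul_of_residue_eq hx
    obtain ⟨v, rfl⟩ := exists_eq_add_mul_of_residue_eq hy
    exact h u v
  rcases hr.step c with h1 | h1 <;> rcases hs.step c with h2 | h2
  · exact Or.inl (conv fun u v => by rw [up hr h1, up hs h2])
  · exact Or.inr (conv fun u v => by rw [up hr h1, down hs h2])
  · exact Or.inr (conv fun u v => by rw [down hr h1, up hs h2])
  · exact Or.inl (conv fun u v => by rw [down hr h1, down hs h2])

theorem sameUpToReversal_of_inversionSet_eq (hr : IsInvariantOrder n r)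
    (hs : IsInvariantOrder n s) (h : inversionSet n r = inversionSet n s) :
    SameUpToReversal n r s := by
  -- Reverse exactly the classes on which the two orders disagree.
  refine ⟨{c | ∃ x y : ℤ, (x : ZMod (2 * n + 1)) = c ∧ (y : ZMod (2 * n + 1)) = c ∧
    r x y ∧ ¬ s x y}, ?_, fun x y => ?_⟩
  · rintro c ⟨x₀, y₀, hx₀, hy₀, h1, h2⟩ x hx z hz y hxy hyz
    rw [mem_residueClass_iff] at hx hz ⊢
    by_contra hy
    rcases hr.iff_or_iff_swap hs c with H | H
    · exact h2 ((H _ _ hx₀ hy₀).2 h1)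
    · have h3 := (iff_of_inversionSet_eq hr hs h (by rw [hx]; exact Ne.symm hy)).1 hxy
      have h4 := (iff_of_inversionSet_eq hr hs h (by rw [hz]; exact hy)).1 hyz
      exact hr.asymm (hr.trans _ _ _ hxy hyz) ((H _ _ hx hz).1 (hs.trans _ _ _ h3 h4))
  · simp only [reverseOn, mem_residueClass_iff, Set.mem_ofPred_eq]
    by_cases hxy : (x : ZMod (2 * n + 1)) = y
    · rcases hr.iff_or_iff_swap hs x with H | H
      · rw [or_iff_right, and_iff_right, H x y rfl hxy.symm]
        · rintro ⟨c, ⟨x₀, y₀, hx₀, hy₀, h1, h2⟩, hx, -⟩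
          exact h2 ((H _ _ (hx₀.trans hx.symm) (hy₀.trans hx.symm)).2 h1)
        · rintro ⟨⟨c, ⟨x₀, y₀, hx₀, hy₀, h1, h2⟩, hx, -⟩, -⟩
          exact h2 ((H _ _ (hx₀.trans hx.symm) (hy₀.trans hx.symm)).2 h1)
      · rcases eq_or_ne x y with rfl | hne
        · simp [hr.irrefl, hs.irrefl]
        · have hR : ∃ c : ℤ, (∃ x y : ℤ, (x : ZMod (2 * n + 1)) = c ∧
              (y : ZMod (2 * n + 1)) = c ∧ r x y ∧ ¬ s x y) ∧
              (x : ZMod (2 * n + 1)) = c ∧ (y : ZMod (2 * n + 1)) = c := by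
            refine ⟨x, ?_, rfl, hxy.symm⟩
            rcases hr.total x y hne with h1 | h1
            · exact ⟨x, y, rfl, hxy.symm, h1, fun h2 =>
                hr.asymm h1 ((H x y rfl hxy.symm).1 h2)⟩
            · exact ⟨y, x, hxy.symm, rfl, h1, fun h2 =>
                hr.asymm h1 ((H y x hxy.symm rfl).1 h2)⟩
          rw [or_iff_left (fun h => h.1 hR), and_iff_right hR, H x y rfl hxy.symm]
    · have hR : ¬ ∃ c : ℤ, (∃ x y : ℤ, (x : ZMod (2 * n + 1)) = c ∧
          (y : ZMod (2 * n + 1)) = c ∧ r x y ∧ ¬ s x y) ∧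
          (x : ZMod (2 * n + 1)) = c ∧ (y : ZMod (2 * n + 1)) = c := by
        rintro ⟨c, -, hx, hy⟩
        exact hxy (hx.trans hy.symm)
      rw [or_iff_right (fun h => hR h.1), and_iff_right hR,
        iff_of_inversionSet_eq hr hs h hxy]

theorem inversionSet_eq_of_sameUpToReversal (h : SameUpToReversal n r s) :
    inversionSet n r = inversionSet n s := by
  obtain ⟨R, -, hR⟩ := h
  have key : ∀ i j, IsRootPair n i j → (s j i ↔ r j i) := by
    intro i j hij
    have hne : ¬ ∃ c ∈ R, j ∈ residueClass n c ∧ i ∈ residueClass n c := by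
      rintro ⟨c, -, hj, hi⟩
      rw [mem_residueClass_iff] at hi hj
      exact (isRootPair_iff.1 hij).2.2.2 (hi.trans hj.symm)
    rw [hR, reverseOn, or_iff_right (fun h => hne h.1), and_iff_right hne]
  ext v
  constructor
  · rintro ⟨i, j, hij, h, rfl⟩
    exact ⟨i, j, hij, (key i j hij).2 h, rfl⟩
  · rintro ⟨i, j, hij, h, rfl⟩
    exact ⟨i, j, hij, (key i j hij).1 h, rfl⟩

end InversionSets

/-! ### Extending comparisons to congruent integers -/

section Extension

variable {n : ℕ}

/-- A relation that compares incongruent integers consistently with an invariant order. -/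
structure IsPartialInvariantOrder (n : ℕ) (A : ℤ → ℤ → Prop) : Prop where
  total : ∀ i j : ℤ, (i : ZMod (2 * n + 1)) ≠ j → A i j ∨ A j i
  asymm : ∀ i j : ℤ, A i j → ¬ A j i
  trans : ∀ i j k : ℤ, (i : ZMod (2 * n + 1)) ≠ k → A i j → A j k → A i k
  shift : ∀ i j m : ℤ, A i j → A (i + m * period n) (j + m * period n)
  negation : ∀ i j : ℤ, A i j → A (-j) (-i)
  -- Stands in for transitivity through `i` and `i + kN`: their class runs in the direction of `k`,
  -- so moving `j` by `tN` in that direction keeps it above `i`.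
  convex : ∀ i j k t : ℤ, (i : ZMod (2 * n + 1)) ≠ j → k ≠ 0 → 0 ≤ t * k → A i j →
    A j (i + k * period n) → A i (j + t * period n)

/-- The comparisons with other residue classes force the class of `i` to be decreasing. -/
def ForcedDown (n : ℕ) (A : ℤ → ℤ → Prop) (i : ℤ) : Prop :=
  ∃ j k : ℤ, (i : ZMod (2 * n + 1)) ≠ j ∧ 0 < k ∧ A (i + k * period n) j ∧ A j i

/-- The extension of `A` to congruent pairs, decreasing on the classes that are forced down. -/
def extend (n : ℕ) (A : ℤ → ℤ → Prop) (i j : ℤ) : Prop :=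
  ((i : ZMod (2 * n + 1)) ≠ j ∧ A i j) ∨
  ((i : ZMod (2 * n + 1)) = j ∧ ((i < j ∧ ¬ ForcedDown n A i) ∨ (j < i ∧ ForcedDown n A i)))

namespace IsPartialInvariantOrder

variable {A : ℤ → ℤ → Prop} (hA : IsPartialInvariantOrder n A)

include hA

theorem forcedDown_congr {i j : ℤ} (h : (i : ZMod (2 * n + 1)) = j) :
    ForcedDown n A i ↔ ForcedDown n A j := by
  have key : ∀ i m : ℤ, ForcedDown n A i → ForcedDown n A (i + m * period n) := by
    rintro i m ⟨j, k, hij, hk, h1, h2⟩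
    refine ⟨j + m * period n, k, ?_, hk, ?_, hA.shift _ _ _ h2⟩
    · rwa [residue_add_mul, residue_add_mul]
    · rw [add_right_comm]
      exact hA.shift _ _ _ h1
  obtain ⟨m, rfl⟩ := exists_eq_add_mul_of_residue_eq h
  exact ⟨fun h => by simpa using key _ (-m) h, key j m⟩

theorem forcedDown_neg {i : ℤ} (h : ForcedDown n A i) : ForcedDown n A (-i) := by
  obtain ⟨j, k, hij, hk, h1, h2⟩ := h
  refine ⟨-j + k * period n, k, ?_, hk, hA.shift _ _ _ (hA.negation _ _ h2), ?_⟩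
  · rw [residue_add_mul, Int.cast_neg, Int.cast_neg, ne_eq, neg_inj]
    exact hij
  · simpa using hA.shift _ _ k (hA.negation _ _ h1)

theorem forcedDown_neg_iff {i : ℤ} : ForcedDown n A (-i) ↔ ForcedDown n A i :=
  ⟨fun h => by simpa using hA.forcedDown_neg h, hA.forcedDown_neg⟩

/-- If `y` forces the class of `x` up and `z` forces it down, convexity puts all `y + tN` with `t ≥
0` above `x` and all `x - tN` above `z`. For `y ≡ z` these clash directly; otherwise one gets `y +
lN ≺ z ≺ x ≺ y + lN`. -/
theorem not_forcedDown {x y k : ℤ} (hxy : (x : ZMod (2 * n + 1)) ≠ y) (hk : 0 < k)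
    (h1 : A x y) (h2 : A y (x + k * period n)) : ¬ ForcedDown n A x := by
  rintro ⟨z, l, hxz, hl, h3, h4⟩
  have h5 : ∀ t : ℤ, 0 ≤ t → A x (y + t * period n) := fun t ht =>
    hA.convex x y k t hxy hk.ne' (mul_nonneg ht hk.le) h1 h2
  have h3' : A x (z + -l * period n) := by simpa using hA.shift _ _ (-l) h3
  have h6 : ∀ t : ℤ, 0 ≤ t → A z (x + -t * period n) := fun t ht =>
    hA.convex z x (-l) (-t) hxz.symm (by omega) (by nlinarith) h4 h3'
  by_cases hyz : (z : ZMod (2 * n + 1)) = y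
  · obtain ⟨s, rfl⟩ := exists_eq_add_mul_of_residue_eq hyz
    have h7 := hA.shift _ _ |s| (h6 |s| (abs_nonneg s))
    rw [show x + -|s| * period n + |s| * period n = x by ring,
      show y + s * period n + |s| * period n = y + (s + |s|) * period n by ring] at h7
    exact hA.asymm _ _ h7 (h5 _ (by linarith [neg_abs_le s]))
  · have h7 : A x (z + (-l + -k) * period n) := by
      have := hA.convex x (z + -l * period n) (-l) (-k) (by rwa [residue_add_mul]) (by omega)
        (by nlinarith) h3' (hA.shift _ _ (-l) h4)
      rwa [add_assoc, ← add_mul] at this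
    have h8 := hA.shift _ _ k h7
    rw [show z + (-l + -k) * period n + k * period n = z + -l * period n by ring] at h8
    have h9 := hA.trans y _ _ (by rw [residue_add_mul]; exact Ne.symm hyz) h2 h8
    have h10 := hA.shift _ _ l h9
    rw [show z + -l * period n + l * period n = z by ring] at h10
    exact hA.asymm _ _ h10
      (hA.trans z x _ (by rwa [residue_add_mul]) h4 (h5 l hl.le))

theorem lt_of_between {i j k : ℤ} (hij : (i : ZMod (2 * n + 1)) ≠ j)
    (hik : (i : ZMod (2 * n + 1)) = k) (h1 : A i j) (h2 : A j k) :
    (i < k ∧ ¬ ForcedDown n A i) ∨ (k < i ∧ ForcedDown n A i) := by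
  obtain ⟨m, rfl⟩ := exists_eq_add_mul_of_residue_eq hik.symm
  have hN := period_pos n
  rcases lt_trichotomy m 0 with hm | rfl | hm
  · refine Or.inr ⟨by nlinarith, ?_⟩
    refine ⟨j + -m * period n, -m, by rwa [residue_add_mul], by omega,
      hA.shift _ _ _ h1, ?_⟩
    simpa using hA.shift _ _ (-m) h2
  · simp only [zero_mul, add_zero] at h2
    exact absurd h2 (hA.asymm _ _ h1)
  · exact Or.inl ⟨by nlinarith, hA.not_forcedDown hij hm h1 h2⟩

theorem extend_asymm {i j : ℤ} (h : extend n A i j) : ¬ extend n A j i := by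
  rintro (⟨h1, h2⟩ | ⟨h1, h2⟩) <;> rcases h with ⟨h3, h4⟩ | ⟨h3, h4⟩
  · exact hA.asymm _ _ h2 h4
  · exact h1 h3.symm
  · exact h3 h1.symm
  · rw [hA.forcedDown_congr h1] at h2
    rcases h2 with h2 | h2 <;> rcases h4 with h4 | h4
    · omega
    · exact h2.2 h4.2
    · exact h4.2 h2.2
    · omega

theorem extend_total {i j : ℤ} (h : i ≠ j) : extend n A i j ∨ extend n A j i := by
  by_cases hij : (i : ZMod (2 * n + 1)) = j
  · have hF := hA.forcedDown_congr hij
    by_cases hi : ForcedDown n A i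
    · rcases lt_or_gt_of_ne h with hlt | hlt
      · exact Or.inr (Or.inr ⟨hij.symm, Or.inr ⟨hlt, hF.1 hi⟩⟩)
      · exact Or.inl (Or.inr ⟨hij, Or.inr ⟨hlt, hi⟩⟩)
    · rcases lt_or_gt_of_ne h with hlt | hlt
      · exact Or.inl (Or.inr ⟨hij, Or.inl ⟨hlt, hi⟩⟩)
      · exact Or.inr (Or.inr ⟨hij.symm, Or.inl ⟨hlt, mt hF.2 hi⟩⟩)
  · rcases hA.total i j hij with h' | h'
    · exact Or.inl (Or.inl ⟨hij, h'⟩)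
    · exact Or.inr (Or.inl ⟨Ne.symm hij, h'⟩)

theorem extend_trans {i j k : ℤ} (h1 : extend n A i j) (h2 : extend n A j k) :
    extend n A i k := by
  have hasymm := h1
  rcases h1 with ⟨hij, h1⟩ | ⟨hij, h1⟩ <;> rcases h2 with ⟨hjk, h2⟩ | ⟨hjk, h2⟩
  · by_cases hik : (i : ZMod (2 * n + 1)) = k
    · exact Or.inr ⟨hik, hA.lt_of_between hij hik h1 h2⟩
    · exact Or.inl ⟨hik, hA.trans _ _ _ hik h1 h2⟩
  · have hik : (i : ZMod (2 * n + 1)) ≠ k := by rwa [← hjk]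
    refine Or.inl ⟨hik, (hA.total _ _ hik).resolve_right fun h => ?_⟩
    -- If `k ≺ i ≺ j`, then `i` separates the congruent `k` and `j` and forces `k` before `j`.
    exact hA.extend_asymm (Or.inr ⟨hjk, h2⟩)
      (Or.inr ⟨hjk.symm, hA.lt_of_between hik.symm hjk.symm h h1⟩)
  · have hik : (i : ZMod (2 * n + 1)) ≠ k := by rwa [hij]
    refine Or.inl ⟨hik, (hA.total _ _ hik).resolve_right fun h => ?_⟩
    exact hA.extend_asymm hasymm
      (Or.inr ⟨hij.symm, hA.lt_of_between hjk hij.symm h2 h⟩)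
  · refine Or.inr ⟨hij.trans hjk, ?_⟩
    rw [← hA.forcedDown_congr hij] at h2
    rcases h1 with h1 | h1 <;> rcases h2 with h2 | h2
    · exact Or.inl ⟨h1.1.trans h2.1, h1.2⟩
    · exact absurd h2.2 h1.2
    · exact absurd h1.2 h2.2
    · exact Or.inr ⟨h2.1.trans h1.1, h1.2⟩

theorem isInvariantOrder_extend : IsInvariantOrder n (extend n A) where
  irrefl i h := hA.extend_asymm h h
  trans i j k := hA.extend_trans
  total i j := hA.extend_total
  translation i j h := by
    have hi : ((i + period n : ℤ) : ZMod (2 * n + 1)) = i := by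
      simpa using residue_add_mul (n := n) i 1
    have hj : ((j + period n : ℤ) : ZMod (2 * n + 1)) = j := by
      simpa using residue_add_mul (n := n) j 1
    rw [extend, hi, hj, hA.forcedDown_congr hi]
    refine h.imp (And.imp_right fun h => ?_) (And.imp_right fun h => ?_)
    · simpa using hA.shift i j 1 h
    · simpa using h
  negation i j h := by
    rw [extend, hA.forcedDown_neg_iff, Int.cast_neg, Int.cast_neg, ne_eq, neg_inj, neg_lt_neg_iff,
      neg_lt_neg_iff]
    refine h.imp (fun h => ⟨Ne.symm h.1, hA.negation _ _ h.2⟩) (fun h => ⟨h.1.symm, ?_⟩)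
    rw [← hA.forcedDown_congr h.1]
    exact h.2

end IsPartialInvariantOrder

end Extension

/-! ### From biclosed sets to orders -/

section Biclosed

/-- The cone-like set generated by the complement of `B` in `P` and by `-B`. -/
def Ascending {V : Type*} [AddCommGroup V] [Module ℝ V] (P B : Set V) (v : V) : Prop :=
  ∃ c : ℝ, 0 < c ∧ (c • v ∈ P \ B ∨ -(c • v) ∈ B)

section General

variable {V : Type*} [AddCommGroup V] [Module ℝ V] {P B : Set V}

theorem Ascending.smul {v : V} (h : Ascending P B v) {t : ℝ} (ht : 0 < t) :
    Ascending P B (t • v) := by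
  obtain ⟨c, hc, h⟩ := h
  refine ⟨c / t, div_pos hc ht, ?_⟩
  rwa [smul_smul, div_mul_cancel₀ _ ht.ne']

theorem IsClosedIn.neg_smul_mem {J : Set V} (hJ : IsClosedIn P J) {x y z : V}
    {a b c : ℝ} (ha : 0 < a) (hb : 0 < b) (hc : 0 < c) (hx : a • x ∈ J) (hy : b • y ∈ J)
    (hz : -(c • z) ∈ P) (h : x + y + z = 0) : -(c • z) ∈ J := by
  refine hJ _ hx _ hy _ hz ⟨c / a, c / b, div_pos hc ha, div_pos hc hb, ?_⟩
  rw [smul_smul, smul_smul, div_mul_cancel₀ _ ha.ne', div_mul_cancel₀ _ hb.ne', ← smul_add,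
    eq_neg_of_add_eq_zero_left h, smul_neg]

/-- Height excludes three vectors of the same sign. With mixed signs, the odd one out is, up to
sign, a positive combination of the other two, against closedness of `B` or of its complement. -/
theorem IsBiclosed.not_ascending_of_add_eq_zero (hB : IsBiclosed P B) {φ : V →ₗ[ℝ] ℝ}
    (hφ : ∀ v ∈ P, 0 < φ v) {x y z : V} (hx : Ascending P B x) (hy : Ascending P B y)
    (hz : Ascending P B z) (h : x + y + z = 0) : False := by
  obtain ⟨hBP, hB1, hB2⟩ := hB
  have pos : ∀ {v : V} {c : ℝ}, 0 < c → c • v ∈ P → 0 < φ v := by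
    intro v c hc hv
    have := hφ _ hv
    rw [map_smul, smul_eq_mul] at this
    exact pos_of_mul_pos_right this hc.le
  have ppn : ∀ {x y z : V} {a b c : ℝ}, 0 < a → 0 < b → 0 < c → a • x ∈ P \ B →
      b • y ∈ P \ B → -(c • z) ∈ B → x + y + z = 0 → False :=
    fun ha hb hc hx hy hz h => (hB2.neg_smul_mem ha hb hc hx hy (hBP hz) h).2 hz
  have nnp : ∀ {x y z : V} {a b c : ℝ}, 0 < a → 0 < b → 0 < c → -(a • x) ∈ B →
      -(b • y) ∈ B → c • z ∈ P \ B → x + y + z = 0 → False := by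
    intro x y z a b c ha hb hc hx hy hz h
    rw [← smul_neg] at hx hy
    rw [← neg_neg z, smul_neg] at hz
    refine hz.2 (hB1.neg_smul_mem ha hb hc hx hy hz.1 ?_)
    rw [← neg_zero, ← h]
    abel
  have hsum : φ x + φ y + φ z = 0 := by rw [← map_add, ← map_add, h, map_zero]
  obtain ⟨a, ha, hx⟩ := hx
  obtain ⟨b, hb, hy⟩ := hy
  obtain ⟨c, hc, hz⟩ := hz
  have h' : x + z + y = 0 := by rw [← h]; abel
  have h'' : y + z + x = 0 := by rw [← h]; abel
  rcases hx with hx | hx <;> rcases hy with hy | hy <;> rcases hz with hz | hz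
  · linarith [pos ha hx.1, pos hb hy.1, pos hc hz.1]
  · exact ppn ha hb hc hx hy hz h
  · exact ppn ha hc hb hx hz hy h'
  · exact nnp hb hc ha hy hz hx h''
  · exact ppn hb hc ha hy hz hx h''
  · exact nnp ha hc hb hx hz hy h'
  · exact nnp ha hb hc hx hy hz h
  · rw [← smul_neg] at hx hy hz
    have h1 := pos ha (hBP hx)
    have h2 := pos hb (hBP hy)
    have h3 := pos hc (hBP hz)
    rw [map_neg] at h1 h2 h3
    linarith

theorem IsBiclosed.not_ascending_neg (hB : IsBiclosed P B) {φ : V →ₗ[ℝ] ℝ}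
    (hφ : ∀ v ∈ P, 0 < φ v) {x : V} (hx : Ascending P B x) : ¬ Ascending P B (-x) := fun h =>
  hB.not_ascending_of_add_eq_zero hφ hx hx (h.smul two_pos) (by module)

end General

variable {n : ℕ} {B : Set (Vec n)}

theorem height_pos {φ : Vec n →ₗ[ℝ] ℝ} (hφ : ∀ i, φ (e n i) = i) :
    ∀ v ∈ posRoots n, 0 < φ v := by
  rintro _ ⟨i, j, hij, rfl⟩
  rw [map_sub, hφ, hφ, sub_pos]
  exact_mod_cast hij.1

theorem ascending_or_ascending {i j : ℤ} (hij : (i : ZMod (2 * n + 1)) ≠ j) :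
    Ascending (posRoots n) B (e n j - e n i) ∨ Ascending (posRoots n) B (e n i - e n j) := by
  have hroot : ∀ i j : ℤ, IsRootPair n i j →
      Ascending (posRoots n) B (e n j - e n i) ∨
        Ascending (posRoots n) B (e n i - e n j) := by
    intro i j h
    by_cases hB : e n j - e n i ∈ B
    · exact Or.inr ⟨1, one_pos, Or.inr (by simpa using hB)⟩
    · exact Or.inl ⟨1, one_pos, Or.inl (by simpa using ⟨⟨i, j, h, rfl⟩, hB⟩)⟩
  have hnonzero : ∀ i j : ℤ, (i : ZMod (2 * n + 1)) ≠ 0 → (j : ZMod (2 * n + 1)) ≠ 0 →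
      (i : ZMod (2 * n + 1)) ≠ j → Ascending (posRoots n) B (e n j - e n i) ∨
        Ascending (posRoots n) B (e n i - e n j) := by
    intro i j hi hj hij
    rcases lt_trichotomy i j with hlt | rfl | hlt
    · exact hroot i j (isRootPair_iff.2 ⟨hlt, hi, hj, hij⟩)
    · exact absurd rfl hij
    · exact (hroot j i (isRootPair_iff.2 ⟨hlt, hj, hi, hij.symm⟩)).symm
  have hzero : ∀ i m : ℤ, (i : ZMod (2 * n + 1)) ≠ 0 →
      Ascending (posRoots n) B (e n (m * period n) - e n i) ∨
        Ascending (posRoots n) B (e n i - e n (m * period n)) := by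
    intro i m hi
    have hc : ((-i + 2 * m * period n : ℤ) : ZMod (2 * n + 1)) = -i := by
      rw [residue_add_mul, Int.cast_neg]
    have he : e n (-i + 2 * m * period n) =
        -e n i + (2 : ℝ) • e n (m * period n) := by
      have h0 : e n (m * period n) = (m : ℝ) • e n (period n) := by
        have h0 : e n 0 = 0 := by
          simpa using e_add_period (n := n) 0
        simpa [h0] using e_add_mul (n := n) 0 m
      rw [e_add_mul, e_neg, h0]
      push_cast
      module
    -- `e_{mN} - e_i` is half of the difference for `i` and its mirror image `-i + 2mN`, hence the
    -- scaling built into `Ascending`.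
    refine (hnonzero i (-i + 2 * m * period n) hi (by rwa [hc, neg_ne_zero])
      (by rw [hc]; exact mt (eq_zero_of_eq_neg_residue _) hi)).imp (fun h => ?_) (fun h => ?_)
    · convert h.smul (t := 1 / 2) (by norm_num) using 1
      rw [he]
      module
    · convert h.smul (t := 1 / 2) (by norm_num) using 1
      rw [he]
      module
  by_cases hj : (j : ZMod (2 * n + 1)) = 0
  · obtain ⟨m, rfl⟩ := residue_eq_zero_iff.1 hj
    rw [mul_comm (period n)]
    exact hzero i m (by rwa [hj] at hij)
  by_cases hi : (i : ZMod (2 * n + 1)) = 0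
  · obtain ⟨m, rfl⟩ := residue_eq_zero_iff.1 hi
    rw [mul_comm (period n)]
    exact (hzero j m hj).symm
  · exact hnonzero i j hi hj hij

theorem IsBiclosed.isPartialInvariantOrder (hB : IsBiclosed (posRoots n) B) :
    IsPartialInvariantOrder n fun i j => Ascending (posRoots n) B (e n j - e n i) := by
  obtain ⟨φ, hφ⟩ := exists_height n
  have hpos := height_pos hφ
  refine ⟨fun i j => ascending_or_ascending, ?_, ?_, ?_, ?_, ?_⟩
  · intro i j h h'
    rw [← neg_sub] at h'
    exact hB.not_ascending_neg hpos h h'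
  · intro i j k hik h1 h2
    refine (ascending_or_ascending hik).resolve_right fun h3 => ?_
    exact hB.not_ascending_of_add_eq_zero hpos h1 h2 h3 (by abel)
  · intro i j m h
    rwa [e_add_mul, e_add_mul, add_sub_add_right_eq_sub]
  · intro i j h
    rwa [e_neg, e_neg, neg_sub_neg]
  · intro i j k t hij hk htk h1 h2
    rcases eq_or_ne t 0 with rfl | ht
    · simpa using h1
    refine (ascending_or_ascending (by rwa [residue_add_mul])).resolve_right fun h3 => ?_
    have hk' : (k : ℝ) ≠ 0 := by exact_mod_cast hk
    have htk' : (0 : ℝ) < t / k := by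
      have h : 0 < t * k := lt_of_le_of_ne htk (mul_ne_zero ht hk).symm
      have h' : (0 : ℝ) < t * k := by exact_mod_cast h
      rcases mul_pos_iff.1 h' with h | h
      · exact div_pos h.1 h.2
      · exact div_pos_of_neg_of_neg h.1 h.2
    -- `e_{j+tN} - e_i = (1 + t/k)(e_j - e_i) + (t/k)(e_{i+kN} - e_j)`.
    refine hB.not_ascending_of_add_eq_zero hpos (h1.smul (t := 1 + t / k) (by positivity))
      (h2.smul htk') h3 ?_
    rw [e_add_mul, e_add_mul, smul_sub, smul_sub, smul_add, smul_smul,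
      div_mul_cancel₀ _ hk']
    module

theorem IsBiclosed.exists_inversionSet_eq (hB : IsBiclosed (posRoots n) B) :
    ∃ r : ℤ → ℤ → Prop, IsInvariantOrder n r ∧ inversionSet n r = B := by
  refine ⟨_, hB.isPartialInvariantOrder.isInvariantOrder_extend, ?_⟩
  obtain ⟨φ, hφ⟩ := exists_height n
  have hpos := height_pos hφ
  have key : ∀ i j, IsRootPair n i j → (extend n
      (fun i j => Ascending (posRoots n) B (e n j - e n i)) j i ↔ e n j - e n i ∈ B) := by
    intro i j hij
    have hne := (isRootPair_iff.1 hij).2.2.2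
    rw [extend, or_iff_left (fun h => hne h.1.symm), and_iff_right hne.symm]
    constructor
    · intro h
      by_contra hn
      rw [← neg_sub] at h
      exact hB.not_ascending_neg hpos
        ⟨1, one_pos, Or.inl (by simpa using ⟨⟨i, j, hij, rfl⟩, hn⟩)⟩ h
    · intro h
      exact ⟨1, one_pos, Or.inr (by simpa using h)⟩
  ext v
  constructor
  · rintro ⟨i, j, hij, h, rfl⟩
    exact (key i j hij).1 h
  · intro h
    obtain ⟨i, j, hij, rfl⟩ := hB.1 h
    exact ⟨i, j, hij, (key i j hij).2 h, rfl⟩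

end Biclosed

end AffineC

theorem mainTheorem7 (n : ℕ) (hn : 1 ≤ n) :
    (∀ r : ℤ → ℤ → Prop, AffineC.IsInvariantOrder n r →
      AffineC.IsBiclosed (AffineC.posRoots n) (AffineC.inversionSet n r)) ∧
    (∀ B : Set (AffineC.Vec n), AffineC.IsBiclosed (AffineC.posRoots n) B →
      ∃ r : ℤ → ℤ → Prop, AffineC.IsInvariantOrder n r ∧ AffineC.inversionSet n r = B) ∧
    (∀ r s : ℤ → ℤ → Prop, AffineC.IsInvariantOrder n r → AffineC.IsInvariantOrder n s →
      (AffineC.inversionSet n r = AffineC.inversionSet n s ↔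
        AffineC.SameUpToReversal n r s)) :=
  ⟨fun _ hr => hr.isBiclosed_inversionSet, fun _ hB => hB.exists_inversionSet_eq,
    fun _ _ hr hs => ⟨AffineC.sameUpToReversal_of_inversionSet_eq hr hs,
      AffineC.inversionSet_eq_of_sameUpToReversal⟩⟩
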